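/- Let $M$ be a smooth ($C^\infty$) Hausdorff manifold without boundary of dimension $n$, $g$ a smooth Riemannian metric on $M$ and $\nabla$ a smooth torsion-free affine connection on $M$. Suppose that $(M,g,\nabla)$ is a statistical manifold, that is, the cubic form $Q(X,Y,Z)=(\nabla_X g)(Y,Z)=X\,g(Y,Z)-g(\nabla_XY,Z)-g(Y,\nabla_XZ)$ is symmetric in $X,Y,Z$. Let $\overset{*}{\nabla}$ be the dual connection, determined by $$X\,g(Y,Z)=g(\nabla_XY,Z)+g(Y,\overset{*}{\nabla}_XZ),$$ and for $\alpha\in\mathbf R$ put $$\nabla^{(\alpha)}=\frac{1+\alpha}{2}\nabla+\frac{1-\alpha}{2}\overset{*}{\nabla}.$$ Suppose that $(M,g,\nabla)$ has constant curvature: there is a real constant $K$ such that the curvature tensor field $R(X,Y)Z=\nabla_X\nabla_YZ-\nabla_Y\nabla_XZ-\nabla_{[X,Y]}Z$ satisfies $$R(X,Y)Z=K\,\{g(Y,Z)X-g(X,Z)Y\}$$ for all smooth vector fields $X,Y,Z$ on $M$. Then for every $\alpha\in\mathbf R$ the connection $\nabla^{(\alpha)}$ is (locally) equiaffine: it is a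 smooth torsion-free affine connection, and every point of $M$ has an open neighbourhood $U$ carrying a parallel volume form, that is, a smooth nowhere vanishing $n$-form $\omega$ on $U$ with $\nabla^{(\alpha)}\omega=0$. -/

import Mathlib

open Bundle Set
open scoped Manifold ContDiff

noncomputable section StatisticalManifolds

namespace StatMfd

variable {n : ℕ} {M : Type*} [TopologicalSpace M] [ChartedSpace (EuclideanSpace ℝ (Fin n)) M]

/-- Affine connections on `M`: covariant derivatives on the tangent bundle.
The vector `∇_X Y` at `x` is written `cov Y x (X x)`. Smoothness is a separate condition. -/
abbrev AffineConnection (n : ℕ) (M : Type*) [TopologicalSpace M]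
    [ChartedSpace (EuclideanSpace ℝ (Fin n)) M] [IsManifold (𝓡 n) ∞ M] :=
  CovariantDerivative (𝓡 n) (EuclideanSpace ℝ (Fin n)) (fun x : M ↦ TangentSpace (𝓡 n) x)

variable [IsManifold (𝓡 n) ∞ M]

/-- The curvature `R(X, Y)Z = ∇_X ∇_Y Z - ∇_Y ∇_X Z - ∇_[X, Y] Z` of an affine connection. -/
def curvature (cov : AffineConnection n M) (X Y Z : Π x : M, TangentSpace (𝓡 n) x) (x : M) :
    TangentSpace (𝓡 n) x :=
  cov (fun y ↦ cov Z y (Y y)) x (X x) - cov (fun y ↦ cov Z y (X y)) x (Y x)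
    - cov Z x (VectorField.mlieBracket (𝓡 n) X Y x)

/-- `X` is a smooth vector field on the set `U`. -/
def IsSmoothFieldOn (X : Π x : M, TangentSpace (𝓡 n) x) (U : Set M) : Prop :=
  ContMDiffOn (𝓡 n) ((𝓡 n).prod 𝓘(ℝ, EuclideanSpace ℝ (Fin n))) ∞
    (fun x ↦ TotalSpace.mk' (EuclideanSpace ℝ (Fin n)) x (X x)) U

/-- The covariant derivative of a field `η` of alternating `n`-forms,
`(∇_X η)(Y₁, …, Yₙ) = X(η(Y₁, …, Yₙ)) - ∑ᵢ η(Y₁, …, ∇_X Yᵢ, …, Yₙ)`. -/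
def covDerivForm (cov : AffineConnection n M)
    (η : Π x : M, TangentSpace (𝓡 n) x [⋀^Fin n]→ₗ[ℝ] ℝ)
    (X : Π x : M, TangentSpace (𝓡 n) x) (Y : Fin n → Π x : M, TangentSpace (𝓡 n) x) (x : M) : ℝ :=
  mvfderiv (𝓡 n) (fun y ↦ η y (fun j ↦ Y j y)) x (X x)
    - ∑ i, η x (Function.update (fun j ↦ Y j x) i (cov (Y i) x (X x)))

/-- `η` is, on the open set `U`, a parallel volume form for the connection: a smooth nowhere
vanishing `n`-form with `∇η = 0`. Smoothness of a form means that its values on smooth vector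
fields are smooth functions. What `η` is outside `U` does not matter. -/
structure IsParallelVolumeFormOn (cov : AffineConnection n M)
    (η : Π x : M, TangentSpace (𝓡 n) x [⋀^Fin n]→ₗ[ℝ] ℝ) (U : Set M) : Prop where
  smooth : ∀ Y : Fin n → Π x : M, TangentSpace (𝓡 n) x, (∀ i, IsSmoothFieldOn (Y i) U) →
    ContMDiffOn (𝓡 n) 𝓘(ℝ) ∞ (fun x ↦ η x (fun i ↦ Y i x)) U
  ne_zero : ∀ x ∈ U, η x ≠ 0
  parallel : ∀ (X : Π x : M, TangentSpace (𝓡 n) x) (Y : Fin n → Π x : M, TangentSpace (𝓡 n) x),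
    IsSmoothFieldOn X U → (∀ i, IsSmoothFieldOn (Y i) U) → ∀ x ∈ U, covDerivForm cov η X Y x = 0

/-- A (locally) equiaffine connection: a smooth torsion-free affine connection which has a parallel
volume form near every point. -/
structure IsEquiaffine (cov : AffineConnection n M) : Prop where
  smooth : CovariantDerivative.ContMDiffCovariantDerivative cov ∞
  torsion_free : cov.torsion = 0
  exists_parallel : ∀ p : M, ∃ U : Set M, IsOpen U ∧ p ∈ U ∧
    ∃ η : Π x : M, TangentSpace (𝓡 n) x [⋀^Fin n]→ₗ[ℝ] ℝ, IsParallelVolumeFormOn cov η U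

variable [RiemannianBundle (fun x : M ↦ TangentSpace (𝓡 n) x)]
  [IsContMDiffRiemannianBundle (𝓡 n) ∞ (EuclideanSpace ℝ (Fin n))
    (fun x : M ↦ TangentSpace (𝓡 n) x)]

instance metric_one : IsContMDiffRiemannianBundle (𝓡 n) 1 (EuclideanSpace ℝ (Fin n))
    (fun x : M ↦ TangentSpace (𝓡 n) x) :=
  IsContMDiffRiemannianBundle.of_le (n := ∞) (by simp)

/-- The cubic form `Q(X, Y, Z) = (∇_X g)(Y, Z) = X g(Y, Z) - g(∇_X Y, Z) - g(Y, ∇_X Z)`,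
where `g` is the Riemannian metric of `M`. -/
def cubicForm (cov : AffineConnection n M) (x : M) (X Y Z : TangentSpace (𝓡 n) x) : ℝ :=
  cov.derivMetricTensor x Y Z X

/-- `(M, g, ∇)` is a statistical manifold: `∇` is a smooth torsion-free affine connection and
the cubic form `Q = ∇g` is symmetric in its three arguments. -/
structure IsStatistical (cov : AffineConnection n M) : Prop where
  smooth : CovariantDerivative.ContMDiffCovariantDerivative cov ∞
  torsion_free : cov.torsion = 0
  symm₁₂ : ∀ (x : M) (X Y Z : TangentSpace (𝓡 n) x),
    cubicForm cov x X Y Z = cubicForm cov x Y X Z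
  symm₂₃ : ∀ (x : M) (X Y Z : TangentSpace (𝓡 n) x),
    cubicForm cov x X Y Z = cubicForm cov x X Z Y

/-- The curvature is constant: `R(X, Y)Z = K (g(Y, Z) X - g(X, Z) Y)` for a real constant `K` and
all smooth vector fields. -/
def HasConstantCurvature (cov : AffineConnection n M) : Prop :=
  ∃ K : ℝ, ∀ X Y Z : Π x : M, TangentSpace (𝓡 n) x,
    IsSmoothFieldOn X univ → IsSmoothFieldOn Y univ → IsSmoothFieldOn Z univ → ∀ x : M,
      curvature cov X Y Z x
        = K • ((inner ℝ (Y x) (Z x) : ℝ) • X x - (inner ℝ (X x) (Z x) : ℝ) • Y x)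

instance tangentSpace_finiteDimensional (x : M) :
    FiniteDimensional ℝ (TangentSpace (𝓡 n) x) :=
  inferInstanceAs (FiniteDimensional ℝ (EuclideanSpace ℝ (Fin n)))

/-- For a trilinear form `B` on a Euclidean space, the bilinear map `C` with
`⟨Y, C Z X⟩ = B Z Y X`. -/
def raiseIndex {V : Type*} [NormedAddCommGroup V] [InnerProductSpace ℝ V] [FiniteDimensional ℝ V]
    (B : V →L[ℝ] V →L[ℝ] V →L[ℝ] ℝ) : V →L[ℝ] V →L[ℝ] V :=
  haveI : CompleteSpace V := FiniteDimensional.complete ℝ V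
  LinearMap.toContinuousBilinearMap <| LinearMap.mk₂ ℝ
    (fun Z X ↦ (InnerProductSpace.toDual ℝ V).symm ((B Z).flip X))
    (by intro a b c; rw [← map_add]; congr 1; ext; simp [B.map_add])
    (by intro r b c; simp only [B.map_smul]
        rw [show r • (InnerProductSpace.toDual ℝ V).symm ((B b).flip c)
          = (InnerProductSpace.toDual ℝ V).symm (r • (B b).flip c) by simp]
        congr 1)
    (by intro a b c; rw [← map_add]; congr 1; ext; simp)
    (by intro a b c; rw [← map_smul]; congr 1; ext; simp)

theorem inner_raiseIndex {V : Type*} [NormedAddCommGroup V] [InnerProductSpace ℝ V]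
    [FiniteDimensional ℝ V] (B : V →L[ℝ] V →L[ℝ] V →L[ℝ] ℝ) (X Y Z : V) :
    inner ℝ Y (raiseIndex B Z X) = B Z Y X := by
  have : CompleteSpace V := FiniteDimensional.complete ℝ V
  rw [real_inner_comm]
  simp [raiseIndex]

/-- The dual connection `∇*`, defined by `X g(Y, Z) = g(∇_X Y, Z) + g(Y, ∇*_X Z)`. This says that
`g(Y, ∇*_X Z - ∇_X Z) = (∇_X g)(Y, Z)`, so `∇*` is `∇` plus the metric dual of `∇g`; see
`dual_spec` and `dual_unique`. -/
def dual (cov : AffineConnection n M) : AffineConnection n M :=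
  cov.addOneForm fun x ↦ raiseIndex (cov.derivMetricTensor x)

theorem dual_apply (cov : AffineConnection n M) (Z : Π x : M, TangentSpace (𝓡 n) x) (x : M)
    (X : TangentSpace (𝓡 n) x) :
    dual cov Z x X = cov Z x X + raiseIndex (cov.derivMetricTensor x) (Z x) X := rfl

/-- The defining equation `X g(Y, Z) = g(∇_X Y, Z) + g(Y, ∇*_X Z)` of the dual connection. -/
theorem dual_spec (cov : AffineConnection n M) (x : M) (X Y Z : Π x : M, TangentSpace (𝓡 n) x)
    (hY : MDifferentiableAt (𝓡 n) ((𝓡 n).prod 𝓘(ℝ, EuclideanSpace ℝ (Fin n)))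
        (fun y ↦ TotalSpace.mk' (EuclideanSpace ℝ (Fin n)) y (Y y)) x) (hZ : MDifferentiableAt (𝓡 n) ((𝓡 n).prod 𝓘(ℝ, EuclideanSpace ℝ (Fin n)))
        (fun y ↦ TotalSpace.mk' (EuclideanSpace ℝ (Fin n)) y (Z y)) x) :
    mvfderiv (𝓡 n) (fun y ↦ (inner ℝ (Y y) (Z y) : ℝ)) x (X x)
      = inner ℝ (cov Y x (X x)) (Z x) + inner ℝ (Y x) (dual cov Z x (X x)) := by
  have hsymm := cov.derivMetricTensor_apply (X := X) x hZ hY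
  have h2 : (fun y ↦ (inner ℝ (Z y) (Y y) : ℝ)) = fun y ↦ inner ℝ (Y y) (Z y) := by
    funext y; exact real_inner_comm _ _
  rw [dual_apply, inner_add_right, inner_raiseIndex, hsymm, h2]
  simp only [real_inner_comm (Z x) (cov Y x (X x)), real_inner_comm (Y x) (cov Z x (X x))]
  ring

/-- The defining equation determines the dual connection. -/
theorem dual_unique (cov cov' : AffineConnection n M)
    (h : ∀ (x : M) (X Y Z : Π x : M, TangentSpace (𝓡 n) x),
      MDifferentiableAt (𝓡 n) ((𝓡 n).prod 𝓘(ℝ, EuclideanSpace ℝ (Fin n)))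
        (fun y ↦ TotalSpace.mk' (EuclideanSpace ℝ (Fin n)) y (Y y)) x → MDifferentiableAt (𝓡 n) ((𝓡 n).prod 𝓘(ℝ, EuclideanSpace ℝ (Fin n)))
        (fun y ↦ TotalSpace.mk' (EuclideanSpace ℝ (Fin n)) y (Z y)) x →
      mvfderiv (𝓡 n) (fun y ↦ (inner ℝ (Y y) (Z y) : ℝ)) x (X x)
        = inner ℝ (cov Y x (X x)) (Z x) + inner ℝ (Y x) (cov' Z x (X x)))
    (x : M) (Z : Π x : M, TangentSpace (𝓡 n) x) (hZ : MDifferentiableAt (𝓡 n) ((𝓡 n).prod 𝓘(ℝ, EuclideanSpace ℝ (Fin n)))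
        (fun y ↦ TotalSpace.mk' (EuclideanSpace ℝ (Fin n)) y (Z y)) x) :
    cov' Z x = dual cov Z x := by
  ext1 v
  refine ext_inner_left ℝ fun w ↦ ?_
  have hw := FiberBundle.mdifferentiableAt_extend (𝓡 n) (EuclideanSpace ℝ (Fin n)) w
  have hv : FiberBundle.extend (EuclideanSpace ℝ (Fin n)) v x = v := by simp
  have hw' : FiberBundle.extend (EuclideanSpace ℝ (Fin n)) w x = w := by simp
  have h1 := h x (FiberBundle.extend (EuclideanSpace ℝ (Fin n)) v) (FiberBundle.extend (EuclideanSpace ℝ (Fin n)) w) Z hw hZ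
  have h2 := dual_spec cov x (FiberBundle.extend (EuclideanSpace ℝ (Fin n)) v) (FiberBundle.extend (EuclideanSpace ℝ (Fin n)) w) Z hw hZ
  rw [h1] at h2
  simpa [hv, hw'] using h2

/-- The `α`-connection `∇^(α) = (1 + α)/2 ∇ + (1 - α)/2 ∇*`. -/
def alphaConnection (cov : AffineConnection n M) (α : ℝ) : AffineConnection n M :=
  cov.affineCombination (dual cov) (fun _ ↦ (1 + α) / 2)

theorem alphaConnection_apply (cov : AffineConnection n M) (α : ℝ)
    (Z : Π x : M, TangentSpace (𝓡 n) x) (x : M) (X : TangentSpace (𝓡 n) x) :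
    alphaConnection cov α Z x X
      = ((1 + α) / 2) • cov Z x X + ((1 - α) / 2) • dual cov Z x X := by
  have h : 1 - (1 + α) / 2 = (1 - α) / 2 := by ring
  rw [← h]
  rfl

end StatMfd

end StatisticalManifolds

open Topology

/-! ### Coordinate frames and the Poincaré lemma -/

namespace StatMfd

variable {n : ℕ} {M : Type*} [TopologicalSpace M] [ChartedSpace (EuclideanSpace ℝ (Fin n)) M]
  [IsManifold (𝓡 n) ∞ M]

/-! For a connection `∇` and a local frame, let `τ` be the trace of its connection form. A volume
form `exp h` times the dual frame determinant is parallel as soon as `dh = τ`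
(`IsCoordFrameOn.isParallelVolumeFormOn`), so the point is to make the trace form of `∇^(α)` exact
near each point.

In a commuting frame `dτ` is the trace of `Z ↦ R(X, Y)Z`. For constant curvature this trace is `K
(g(Y, X) - g(X, Y)) = 0`, hence `τ = dφ` on a coordinate ball
(`IsCoordFrameOn.mvfderiv_trace_connMatrix_symm` and the Poincaré lemma). Duality gives `τ + τ* = d
log D`, with `D` the Gram determinant of the frame (`IsCoordFrameOn.mvfderiv_det_gram`). Therefore
the trace form of `∇^(α)` is `α τ + (1 - α)/2 d log D`, with primitive `α φ + (1 - α)/2 log D`.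

Vanishing torsion comes from the symmetry of the cubic form, which is the difference of `∇*` and `∇`
up to raising an index. The smoothness of `∇*` is read off from its pairings with a frame. -/

/-- The `i`-th coordinate vector field of the preferred chart at `p`, as a vector field on `M`
(zero outside the domain of the chart). -/
noncomputable def coordField (p : M) (i : Fin n) : Π x : M, TangentSpace (𝓡 n) x :=
  (trivializationAt (EuclideanSpace ℝ (Fin n)) (TangentSpace (𝓡 n)) p).localFrame
    (EuclideanSpace.basisFun (Fin n) ℝ).toBasis i

/-- The trivialization of the tangent bundle at `p` acts on fibres as the derivative of the chart.
This links the bundle frame, convenient for smoothness, with constant fields in the chart,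
convenient for brackets and partial derivatives. -/
theorem mfderiv_extChartAt_coordField {p x : M} (hx : x ∈ (extChartAt (𝓡 n) p).source)
    (i : Fin n) :
    mfderiv (𝓡 n) 𝓘(ℝ, EuclideanSpace ℝ (Fin n)) (extChartAt (𝓡 n) p) x (coordField p i x)
      = (NormedSpace.fromTangentSpace (𝕜 := ℝ) (extChartAt (𝓡 n) p x)).symm
        (EuclideanSpace.basisFun (Fin n) ℝ i) := by
  have hx' : x ∈ (chartAt (EuclideanSpace ℝ (Fin n)) p).source := by simpa using hx
  have hb : x ∈ (trivializationAt (EuclideanSpace ℝ (Fin n)) (TangentSpace (𝓡 n)) p).baseSet := by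
    simpa using hx'
  have h1 : (trivializationAt (EuclideanSpace ℝ (Fin n))
      (TangentSpace (𝓡 n)) p).continuousLinearMapAt ℝ x (coordField p i x) = EuclideanSpace.basisFun (Fin n) ℝ i := by
    rw [coordField, Trivialization.localFrame_apply_of_mem_baseSet _ _ hb, Trivialization.basisAt]
    have := ((trivializationAt (EuclideanSpace ℝ (Fin n)) (TangentSpace (𝓡 n)) p).linearEquivAt
      (R := ℝ) x hb).apply_symm_apply (EuclideanSpace.basisFun (Fin n) ℝ i)
    rw [Trivialization.continuousLinearMapAt_apply, Trivialization.coe_linearMapAt_of_mem _ hb]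
    simpa using! this
  rw [TangentBundle.continuousLinearMapAt_trivializationAt hx'] at h1
  exact h1

theorem coordField_eventuallyEq_mpullback {p x : M} (hx : x ∈ (extChartAt (𝓡 n) p).source)
    (i : Fin n) :
    ∀ᶠ y in 𝓝 x, coordField p i y = VectorField.mpullback (𝓡 n) 𝓘(ℝ, EuclideanSpace ℝ (Fin n))
      (extChartAt (𝓡 n) p) (fun y ↦ (NormedSpace.fromTangentSpace (𝕜 := ℝ) y).symm
        (EuclideanSpace.basisFun (Fin n) ℝ i)) y := by
  filter_upwards [(isOpen_extChartAt_source p).mem_nhds hx] with y hy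
  rw [VectorField.mpullback_apply, eq_comm, (isInvertible_mfderiv_extChartAt hy).inverse_apply_eq,
    mfderiv_extChartAt_coordField hy]

theorem mdifferentiableAt_constField (v y : EuclideanSpace ℝ (Fin n)) :
    MDifferentiableAt 𝓘(ℝ, EuclideanSpace ℝ (Fin n))
      (𝓘(ℝ, EuclideanSpace ℝ (Fin n)).prod 𝓘(ℝ, EuclideanSpace ℝ (Fin n)))
      (fun y ↦ TotalSpace.mk' (EuclideanSpace ℝ (Fin n)) y
        ((NormedSpace.fromTangentSpace (𝕜 := ℝ) y).symm v)) y := by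
  refine ContMDiffAt.mdifferentiableAt (n := 1) ?_ one_ne_zero
  exact contMDiffAt_vectorSpace_iff_contDiffAt.2 (contDiffAt_const (c := v))

/-- Pullback by the chart commutes with the Lie bracket, and constant fields on a Euclidean space
commute. -/
theorem mlieBracket_coordField {p x : M} (hx : x ∈ (extChartAt (𝓡 n) p).source) (i j : Fin n) :
    VectorField.mlieBracket (𝓡 n) (coordField p i) (coordField p j) x = 0 := by
  have : IsManifold (𝓡 n) (minSmoothness ℝ 2) M := .of_le (n := ∞) (by simp; norm_cast)
  have : IsManifold (𝓡 n) (minSmoothness ℝ 3) M := .of_le (n := ∞) (by simp; norm_cast)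
  rw [Filter.EventuallyEq.mlieBracket_vectorField_eq (coordField_eventuallyEq_mpullback hx i)
    (coordField_eventuallyEq_mpullback hx j), ← VectorField.mpullback_mlieBracket (n := ∞)
      (mdifferentiableAt_constField _ _) (mdifferentiableAt_constField _ _)
      (contMDiffAt_extChartAt' (by simpa using hx)) (by simp; norm_cast), VectorField.mpullback_apply]
  have : VectorField.mlieBracket 𝓘(ℝ, EuclideanSpace ℝ (Fin n))
      (fun y ↦ (NormedSpace.fromTangentSpace (𝕜 := ℝ) y).symm
        (EuclideanSpace.basisFun (Fin n) ℝ i))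
      (fun y ↦ (NormedSpace.fromTangentSpace (𝕜 := ℝ) y).symm (EuclideanSpace.basisFun (Fin n) ℝ j)) (extChartAt (𝓡 n) p x) = 0 := by
    rw [← VectorField.mlieBracketWithin_univ, VectorField.mlieBracketWithin_eq_lieBracketWithin]
    have hc (v u : EuclideanSpace ℝ (Fin n)) : fderivWithin ℝ (fun _ ↦ v) univ u
      = (0 : EuclideanSpace ℝ (Fin n) →L[ℝ] EuclideanSpace ℝ (Fin n))
        := fderivWithin_const_apply v
    exact (congrArg₂ (· - ·) (DFunLike.congr_fun (hc _ _) _)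
      (DFunLike.congr_fun (hc _ _) _)).trans (sub_zero _)
  rw [this, map_zero]

theorem mvfderiv_coordField {p x : M} (hx : x ∈ (extChartAt (𝓡 n) p).source) (i : Fin n)
    {f : M → ℝ} (hf : MDifferentiableAt (𝓡 n) 𝓘(ℝ) f x) :
    mvfderiv (𝓡 n) f x (coordField p i x)
      = fderiv ℝ (f ∘ (extChartAt (𝓡 n) p).symm) (extChartAt (𝓡 n) p x)
          (EuclideanSpace.basisFun (Fin n) ℝ i) := by
  have hg : MDifferentiableAt 𝓘(ℝ, EuclideanSpace ℝ (Fin n)) 𝓘(ℝ)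
      (f ∘ (extChartAt (𝓡 n) p).symm) (extChartAt (𝓡 n) p x) := by
    refine MDifferentiableAt.comp _ (by rwa [(extChartAt (𝓡 n) p).left_inv hx]) ?_
    have := mdifferentiableWithinAt_extChartAt_symm (I := 𝓡 n) ((extChartAt (𝓡 n) p).map_source hx)
    simpa [mdifferentiableWithinAt_univ] using this
  have heq : f =ᶠ[𝓝 x] (f ∘ (extChartAt (𝓡 n) p).symm) ∘ (extChartAt (𝓡 n) p) := by
    filter_upwards [(isOpen_extChartAt_source p).mem_nhds hx] with y hy
    rw [Function.comp_apply, Function.comp_apply, (extChartAt (𝓡 n) p).left_inv hy]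
  have h1 : mvfderiv (𝓡 n) f x (coordField p i x)
      = mvfderiv (𝓡 n) ((f ∘ (extChartAt (𝓡 n) p).symm) ∘ (extChartAt (𝓡 n) p)) x
        (coordField p i x) := by
    unfold mvfderiv
    have := heq.mfderiv_eq (I := 𝓡 n) (I' := 𝓘(ℝ))
    exact DFunLike.congr_fun this (coordField p i x)
  rw [h1, mvfderiv_comp_apply x hg (mdifferentiableAt_extChartAt (by simpa using hx)),
    mfderiv_extChartAt_coordField hx, mvfderiv, mfderiv_eq_fderiv]
  rfl

/-- `s` is a frame of commuting vector fields over the open set `U`, each of them the restriction of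
a smooth vector field on `M`, for which the Poincaré lemma holds on `U`. -/
structure IsCoordFrameOn (s : Fin n → Π x : M, TangentSpace (𝓡 n) x) (U : Set M) : Prop where
  isOpen : IsOpen U
  smooth : ∀ i, IsSmoothFieldOn (s i) univ
  frame : IsLocalFrameOn (𝓡 n) (EuclideanSpace ℝ (Fin n)) ∞ s U
  mlieBracket_eq_zero : ∀ i j, ∀ x ∈ U, VectorField.mlieBracket (𝓡 n) (s i) (s j) x = 0
  contMDiffOn_mvfderiv : ∀ f : M → ℝ, ContMDiffOn (𝓡 n) 𝓘(ℝ) ∞ f U → ∀ i,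
    ContMDiffOn (𝓡 n) 𝓘(ℝ) ∞ (fun x ↦ mvfderiv (𝓡 n) f x (s i x)) U
  exists_primitive : ∀ a : Fin n → M → ℝ, (∀ i, ContMDiffOn (𝓡 n) 𝓘(ℝ) ∞ (a i) U) →
    (∀ i j, ∀ x ∈ U, mvfderiv (𝓡 n) (a i) x (s j x) = mvfderiv (𝓡 n) (a j) x (s i x)) →
    ∃ f : M → ℝ, ContMDiffOn (𝓡 n) 𝓘(ℝ) ∞ f U ∧
      ∀ i, ∀ x ∈ U, mvfderiv (𝓡 n) f x (s i x) = a i x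

/-- The Poincaré lemma on a convex open subset of a Euclidean space, in coordinates. -/
theorem exists_primitive_of_convex {S : Set (EuclideanSpace ℝ (Fin n))} (hS : Convex ℝ S)
    (hSo : IsOpen S) (a : Fin n → EuclideanSpace ℝ (Fin n) → ℝ) (ha : ∀ i, ContDiffOn ℝ ∞ (a i) S)
    (hsymm : ∀ i j, ∀ u ∈ S, fderiv ℝ (a i) u (EuclideanSpace.basisFun (Fin n) ℝ j)
      = fderiv ℝ (a j) u (EuclideanSpace.basisFun (Fin n) ℝ i)) :
    ∃ f : EuclideanSpace ℝ (Fin n) → ℝ, ContDiffOn ℝ ∞ f S ∧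
      ∀ i, ∀ u ∈ S, fderiv ℝ f u (EuclideanSpace.basisFun (Fin n) ℝ i) = a i u := by
  let proj (i : Fin n) : EuclideanSpace ℝ (Fin n) →L[ℝ] ℝ := EuclideanSpace.proj i
  -- The 1-form `∑ aᵢ dxᵢ`; the hypothesis on the partial derivatives is its closedness.
  let θ : EuclideanSpace ℝ (Fin n) → EuclideanSpace ℝ (Fin n) →L[ℝ] ℝ :=
    fun u ↦ ∑ i, a i u • proj i
  have hθ : ContDiffOn ℝ ∞ θ S := ContDiffOn.sum fun i _ ↦ (ha i).smul contDiffOn_const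
  have hd (i : Fin n) {u} (hu : u ∈ S) : DifferentiableAt ℝ (a i) u :=
    ((ha i).contDiffAt (hSo.mem_nhds hu)).differentiableAt (by simp)
  have hderiv {u} (hu : u ∈ S) (v w : EuclideanSpace ℝ (Fin n)) :
      fderiv ℝ θ u v w = ∑ i, fderiv ℝ (a i) u v * w i := by
    have : HasFDerivAt θ (∑ i, (fderiv ℝ (a i) u).smulRight (proj i)) u :=
      HasFDerivAt.fun_sum fun i _ ↦ (hd i hu).hasFDerivAt.smul_const (proj i)
    simp [this.fderiv, proj]
  have hexp {u} (i : Fin n) (v : EuclideanSpace ℝ (Fin n)) : fderiv ℝ (a i) u v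
      = ∑ j, v j * fderiv ℝ (a i) u (EuclideanSpace.basisFun (Fin n) ℝ j) := by
    conv_lhs => rw [← (EuclideanSpace.basisFun (Fin n) ℝ).sum_repr v]
    simp
  obtain ⟨f, hf⟩ := hS.exists_forall_hasFDerivAt_of_fderiv_symmetric hSo
    (hθ.differentiableOn (by simp)) (fun u hu v w ↦ by
      rw [hderiv hu, hderiv hu]
      simp_rw [fun i ↦ hexp (u := u) i v, fun i ↦ hexp (u := u) i w, Finset.sum_mul]
      rw [Finset.sum_comm]
      refine Finset.sum_congr rfl fun i _ ↦ Finset.sum_congr rfl fun j _ ↦ ?_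
      rw [hsymm j i u hu]
      ring)
  refine ⟨f, ?_, fun i u hu ↦ ?_⟩
  -- The primitive is a priori only differentiable, but its derivative is the smooth form `θ`.
  · rw [contDiffOn_infty_iff_fderiv_of_isOpen hSo]
    exact ⟨fun u hu ↦ (hf u hu).differentiableAt.differentiableWithinAt,
      hθ.congr fun u hu ↦ (hf u hu).fderiv⟩
  · rw [(hf u hu).fderiv]
    simp [θ, proj]

/-- Near every point, the coordinate vector fields of a chart form a coordinate frame. -/
theorem exists_isCoordFrameOn [T2Space M] (p : M) :
    ∃ (U : Set M) (s : Fin n → Π x : M, TangentSpace (𝓡 n) x), p ∈ U ∧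
      (∀ i, ∀ x ∈ U, s i x = coordField p i x) ∧ IsCoordFrameOn s U := by
  let c := extChartAt (𝓡 n) p
  -- The curvature hypothesis speaks only of fields smooth on all of `M`, so the coordinate fields
  -- are cut off by a bump function.
  let ψ : SmoothBumpFunction (𝓡 n) p := Classical.arbitrary _
  let s : Fin n → Π x : M, TangentSpace (𝓡 n) x := fun i x ↦ ψ x • coordField p i x
  have hbase : (trivializationAt (EuclideanSpace ℝ (Fin n)) (TangentSpace (𝓡 n)) p).baseSet
      = c.source := by simp [c]
  have hV : {x | ψ x = 1} ∈ 𝓝 p := ψ.eventuallyEq_one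
  -- A ball serves two purposes: it is convex, for the Poincaré lemma, and it can be taken so small
  -- that the cut-off fields agree with the coordinate fields over it.
  obtain ⟨r, hr, hball⟩ : ∃ r > 0, Metric.ball (c p) r ⊆ c.target ∩ c.symm ⁻¹' {x | ψ x = 1} := by
    refine Metric.mem_nhds_iff.1 (Filter.inter_mem (extChartAt_target_mem_nhds p) ?_)
    exact (continuousAt_extChartAt_symm p).preimage_mem_nhds
      (by rwa [(extChartAt (𝓡 n) p).left_inv (mem_extChartAt_source p)])
  set B := Metric.ball (c p) r
  let U := c.source ∩ c ⁻¹' B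
  have hU : IsOpen U := (continuousOn_extChartAt p).isOpen_inter_preimage
    (isOpen_extChartAt_source p) Metric.isOpen_ball
  have hcB {x} (hx : x ∈ U) : c x ∈ B := hx.2
  have hsU {x} (hx : x ∈ U) (i : Fin n) : s i x = coordField p i x := by
    have : ψ (c.symm (c x)) = 1 := (hball (hcB hx)).2
    rw [c.left_inv hx.1] at this
    simp [s, this]
  have hsymmU {u} (hu : u ∈ B) : c.symm u ∈ U :=
    ⟨c.map_target (hball hu).1, by rwa [mem_preimage, c.right_inv (hball hu).1]⟩
  have hpull {f : M → ℝ} (hf : ContMDiffOn (𝓡 n) 𝓘(ℝ) ∞ f U) : ContDiffOn ℝ ∞ (f ∘ c.symm) B := by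
    rw [← contMDiffOn_iff_contDiffOn]
    exact hf.comp ((contMDiffOn_extChartAt_symm p).mono fun u hu ↦ (hball hu).1)
      fun u hu ↦ hsymmU hu
  have hpush {g : EuclideanSpace ℝ (Fin n) → ℝ} (hg : ContDiffOn ℝ ∞ g B) :
      ContMDiffOn (𝓡 n) 𝓘(ℝ) ∞ (g ∘ c) U :=
    (contMDiffOn_iff_contDiffOn.2 hg).comp
      ((contMDiffOn_extChartAt (x := p)).mono fun x hx ↦ by simpa [c] using hx.1) fun x hx ↦ hcB hx
  have hder {f : M → ℝ} (hf : ContMDiffOn (𝓡 n) 𝓘(ℝ) ∞ f U) (i : Fin n) {x} (hx : x ∈ U) :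
      mvfderiv (𝓡 n) f x (s i x) = fderiv ℝ (f ∘ c.symm) (c x)
        (EuclideanSpace.basisFun (Fin n) ℝ i) := by
    rw [hsU hx]
    exact mvfderiv_coordField hx.1 i
      ((hf.contMDiffAt (hU.mem_nhds hx)).mdifferentiableAt (by simp))
  refine ⟨U, s, ⟨mem_extChartAt_source p, Metric.mem_ball_self hr⟩, fun i x hx ↦ hsU hx i, hU,
    fun i ↦ ?_, ?_, ?_, ?_, ?_⟩
  · refine contMDiffOn_univ.2 (ContMDiffOn.smul_section_of_tsupport (u := c.source)
      ψ.contMDiff.contMDiffOn (isOpen_extChartAt_source p)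
      ψ.tsupport_subset_extChartAt_source ?_)
    rw [← hbase]
    exact Trivialization.contMDiffOn_localFrame_baseSet _ _ _ _
  · refine ((Trivialization.isLocalFrameOn_localFrame_baseSet (𝓡 n) ∞
      (trivializationAt (EuclideanSpace ℝ (Fin n)) (TangentSpace (𝓡 n)) p)
      (EuclideanSpace.basisFun (Fin n) ℝ).toBasis).mono ?_).congr fun i x hx ↦ (hsU hx i).symm
    rw [hbase]
    exact inter_subset_left
  · intro i j x hx
    have h (i) : ∀ᶠ y in 𝓝 x, s i y = coordField p i y := by
      filter_upwards [hU.mem_nhds hx] with y hy using hsU hy i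
    rw [Filter.EventuallyEq.mlieBracket_vectorField_eq (h i) (h j), mlieBracket_coordField hx.1]
  · intro f hf i
    have h1 : ContDiffOn ℝ ∞ (fun u ↦ fderiv ℝ (f ∘ c.symm) u
        (EuclideanSpace.basisFun (Fin n) ℝ i)) B :=
      ((contDiffOn_infty_iff_fderiv_of_isOpen Metric.isOpen_ball).1 (hpull hf)).2.clm_apply
        contDiffOn_const
    exact (hpush h1).congr fun x hx ↦ hder hf i hx
  · intro a ha hsymm
    obtain ⟨f, hf, hfa⟩ := exists_primitive_of_convex (convex_ball (c p) r) Metric.isOpen_ball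
      (fun i ↦ a i ∘ c.symm) (fun i ↦ hpull (ha i)) (fun i j u hu ↦ by
        have h := hsymm i j (c.symm u) (hsymmU hu)
        rwa [hder (ha i) _ (hsymmU hu), hder (ha j) _ (hsymmU hu), c.right_inv (hball hu).1] at h)
    refine ⟨f ∘ c, hpush hf, fun i x hx ↦ ?_⟩
    have heq : (f ∘ c) ∘ c.symm =ᶠ[𝓝 (c x)] f := by
      filter_upwards [Metric.isOpen_ball.mem_nhds (hcB hx)] with u hu
      simp [c.right_inv (hball hu).1]
    rw [hder (hpush hf) i hx, heq.fderiv_eq, hfa i _ (hcB hx), Function.comp_apply,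
      c.left_inv hx.1]

end StatMfd

/-! ### Derivatives of determinants -/

namespace StatMfd

variable {n : ℕ} {M : Type*} [TopologicalSpace M] [ChartedSpace (EuclideanSpace ℝ (Fin n)) M]

section Determinant

/-- Each determinant is expanded along its replaced row by Cramer's rule. Both Jacobi's formula and
the sum in the covariant derivative of an `n`-form have this shape. -/
theorem sum_det_updateRow {ι R : Type*} [Fintype ι] [DecidableEq ι] [CommRing R]
    (A C : Matrix ι ι R) :
    ∑ j, (A.updateRow j (C j)).det = (C * A.adjugate).trace := by
  refine Finset.sum_congr rfl fun j _ ↦ ?_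
  rw [← Matrix.cramer_transpose_apply, Matrix.cramer_eq_adjugate_mulVec, Matrix.diag_apply,
    Matrix.mul_apply, ← Matrix.adjugate_transpose]
  simp [Matrix.mulVec, dotProduct, mul_comm]

theorem mvfderiv_fun_sum {ι : Type*} (t : Finset ι) {f : ι → M → ℝ} {x : M}
    (hf : ∀ i ∈ t, MDifferentiableAt (𝓡 n) 𝓘(ℝ) (f i) x) :
    MDifferentiableAt (𝓡 n) 𝓘(ℝ) (fun y ↦ ∑ i ∈ t, f i y) x ∧
    ∀ v, mvfderiv (𝓡 n) (fun y ↦ ∑ i ∈ t, f i y) x v = ∑ i ∈ t, mvfderiv (𝓡 n) (f i) x v := by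
  classical
  induction t using Finset.induction_on with
  | empty => exact ⟨by simpa using mdifferentiableAt_const, by simp [mvfderiv_const]⟩
  | insert i t hi IH =>
    obtain ⟨h1, h2⟩ := IH fun j hj ↦ hf j (Finset.mem_insert_of_mem hj)
    have h3 := hf i (Finset.mem_insert_self i t)
    simp only [Finset.sum_insert hi]
    refine ⟨h3.add h1, fun v ↦ ?_⟩
    rw [mvfderiv_fun_add h3 h1, add_apply, h2]

theorem mvfderiv_fun_prod {ι : Type*} [DecidableEq ι] (t : Finset ι) {f : ι → M → ℝ} {x : M}
    (hf : ∀ i ∈ t, MDifferentiableAt (𝓡 n) 𝓘(ℝ) (f i) x) :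
    MDifferentiableAt (𝓡 n) 𝓘(ℝ) (fun y ↦ ∏ i ∈ t, f i y) x ∧
    ∀ v, mvfderiv (𝓡 n) (fun y ↦ ∏ i ∈ t, f i y) x v
      = ∑ i ∈ t, mvfderiv (𝓡 n) (f i) x v * ∏ j ∈ t.erase i, f j x := by
  induction t using Finset.induction_on with
  | empty => exact ⟨by simpa using mdifferentiableAt_const, by simp [mvfderiv_const]⟩
  | insert i t hi IH =>
    obtain ⟨h1, h2⟩ := IH fun j hj ↦ hf j (Finset.mem_insert_of_mem hj)
    have h3 := hf i (Finset.mem_insert_self i t)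
    simp only [Finset.prod_insert hi]
    refine ⟨h3.mul h1, fun v ↦ ?_⟩
    rw [mvfderiv_fun_mul h3 h1, add_apply, smul_apply, smul_apply, h2, Finset.sum_insert hi,
      Finset.erase_insert hi, smul_eq_mul, smul_eq_mul, add_comm, mul_comm, Finset.mul_sum]
    congr 1
    refine Finset.sum_congr rfl fun j hj ↦ ?_
    rw [Finset.erase_insert_of_ne (by rintro rfl; exact hi hj),
      Finset.prod_insert (fun h ↦ hi (Finset.mem_of_mem_erase h))]
    ring

/-- Jacobi's formula for the derivative of a determinant. -/
theorem mvfderiv_det {ι : Type*} [Fintype ι] [DecidableEq ι] {a : ι → ι → M → ℝ} {x : M}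
    (ha : ∀ i j, MDifferentiableAt (𝓡 n) 𝓘(ℝ) (a i j) x) (v : TangentSpace (𝓡 n) x) :
    mvfderiv (𝓡 n) (fun y ↦ (Matrix.of fun i j ↦ a i j y).det) x v
      = (Matrix.of (fun i j ↦ mvfderiv (𝓡 n) (a i j) x v)
          * (Matrix.of fun i j ↦ a i j x).adjugate).trace := by
  have hprod (σ : Equiv.Perm ι) := mvfderiv_fun_prod (n := n) (x := x) Finset.univ
    (f := fun i ↦ a i (σ i)) fun i _ ↦ ha i (σ i)
  have h := mvfderiv_fun_sum (n := n) (x := x) Finset.univ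
    (f := fun (σ : Equiv.Perm ι) y ↦ ((Equiv.Perm.sign σ : ℤ) : ℝ) * ∏ i, a i (σ i) y)
    fun σ _ ↦ mdifferentiableAt_const.mul (hprod σ).1
  -- The Leibniz formula is transposed so that each factor lies in its own row; replacing a row then
  -- changes exactly one factor.
  have hdet (A : Matrix ι ι ℝ) : A.det
      = ∑ σ : Equiv.Perm ι, ((Equiv.Perm.sign σ : ℤ) : ℝ) * ∏ i, A i (σ i) := by
    rw [← Matrix.det_transpose, Matrix.det_apply']
    rfl
  simp_rw [hdet, Matrix.of_apply]
  rw [h.2, ← sum_det_updateRow]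
  simp_rw [hdet]
  rw [Finset.sum_comm]
  refine Finset.sum_congr rfl fun σ _ ↦ ?_
  rw [mvfderiv_fun_mul mdifferentiableAt_const (hprod σ).1, mvfderiv_const, smul_zero, add_zero,
    smul_apply, (hprod σ).2, smul_eq_mul, Finset.mul_sum]
  refine Finset.sum_congr rfl fun i _ ↦ ?_
  rw [← Finset.mul_prod_erase _ _ (Finset.mem_univ i)]
  congr 2
  · simp
  · refine Finset.prod_congr rfl fun j hj ↦ ?_
    simp [Matrix.updateRow_ne (Finset.ne_of_mem_erase hj)]

theorem contMDiffOn_det {ι : Type*} [Fintype ι] [DecidableEq ι] {a : ι → ι → M → ℝ} {U : Set M}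
    (ha : ∀ i j, ContMDiffOn (𝓡 n) 𝓘(ℝ) ∞ (a i j) U) :
    ContMDiffOn (𝓡 n) 𝓘(ℝ) ∞ (fun y ↦ (Matrix.of fun i j ↦ a i j y).det) U := by
  simp_rw [Matrix.det_apply']
  exact contMDiffOn_finsetSum fun σ _ ↦ contMDiffOn_const.mul
    (contMDiffOn_finsetProd fun i _ ↦ ha _ _)

end Determinant

theorem mvfderiv_comp_deriv {g : ℝ → ℝ} {g' : ℝ} {f : M → ℝ} {x : M} (hg : HasDerivAt g g' (f x))
    (hf : MDifferentiableAt (𝓡 n) 𝓘(ℝ) f x) :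
    MDifferentiableAt (𝓡 n) 𝓘(ℝ) (fun y ↦ g (f y)) x ∧
      ∀ v, mvfderiv (𝓡 n) (fun y ↦ g (f y)) x v = g' * mvfderiv (𝓡 n) f x v := by
  have hg' : MDifferentiableAt 𝓘(ℝ) 𝓘(ℝ) g (f x) := hg.differentiableAt.mdifferentiableAt
  refine ⟨hg'.comp x hf, fun v ↦ ?_⟩
  have h := mvfderiv_comp_apply x hg' hf v
  have h2 : mvfderiv 𝓘(ℝ) g (f x) (mfderiv (𝓡 n) 𝓘(ℝ) f x v) = g' * mvfderiv (𝓡 n) f x v := by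
    rw [mvfderiv, mfderiv_eq_fderiv, hg.hasFDerivAt.fderiv]
    exact mul_comm _ _
  exact h.trans h2

end StatMfd

/-! ### Components in a coordinate frame -/

namespace StatMfd

variable {n : ℕ} {M : Type*} [TopologicalSpace M] [ChartedSpace (EuclideanSpace ℝ (Fin n)) M]
  [IsManifold (𝓡 n) ∞ M]

section Frame

variable {s : Fin n → Π x : M, TangentSpace (𝓡 n) x} {U : Set M}

theorem IsCoordFrameOn.sum_coeff (hs : IsCoordFrameOn s U) {x : M} (hx : x ∈ U)
    (v : TangentSpace (𝓡 n) x) : ∑ i, hs.frame.coeff i x v • s i x = v := by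
  have h := (hs.frame.toBasisAt hx).sum_repr v
  simpa [IsLocalFrameOn.coeff, hx] using h

theorem IsCoordFrameOn.coeff_self (hs : IsCoordFrameOn s U) {x : M} (hx : x ∈ U) (i j : Fin n) :
    hs.frame.coeff i x (s j x) = if i = j then 1 else 0 := by
  have h := (hs.frame.toBasisAt hx).repr_self j
  rw [hs.frame.toBasisAt_coe hx] at h
  simp only [IsLocalFrameOn.coeff, hx, dif_pos, Module.Basis.coord_apply, h, Finsupp.single_apply,
    eq_comm]

theorem IsSmoothFieldOn.mdifferentiableAt {X : Π x : M, TangentSpace (𝓡 n) x}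
    (hX : IsSmoothFieldOn X U) {x : M} (hU : U ∈ 𝓝 x) :
    MDifferentiableAt (𝓡 n) ((𝓡 n).prod 𝓘(ℝ, EuclideanSpace ℝ (Fin n)))
      (fun y ↦ TotalSpace.mk' (EuclideanSpace ℝ (Fin n)) y (X y)) x :=
  (hX.contMDiffAt hU).mdifferentiableAt (by simp)

theorem IsCoordFrameOn.isSmoothFieldOn (hs : IsCoordFrameOn s U) (i : Fin n) :
    IsSmoothFieldOn (s i) U := hs.frame.contMDiffOn i

/-- A smooth connection maps smooth vector fields to smooth vector fields. -/
theorem isSmoothFieldOn_cov {cov : AffineConnection n M}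
    (hcov : CovariantDerivative.ContMDiffCovariantDerivative cov ∞)
    {X Y : Π x : M, TangentSpace (𝓡 n) x} (hX : IsSmoothFieldOn X univ)
    (hY : IsSmoothFieldOn Y univ) : IsSmoothFieldOn (fun x ↦ cov Y x (X x)) univ :=
  ContMDiffOn.clm_bundle_apply (hcov.contMDiff.contMDiff (by simpa [IsSmoothFieldOn] using hY)) hX

variable [RiemannianBundle (fun x : M ↦ TangentSpace (𝓡 n) x)]

theorem IsCoordFrameOn.det_gram_pos (hs : IsCoordFrameOn s U) {x : M} (hx : x ∈ U) :
    0 < (Matrix.of fun i j ↦ (inner ℝ (s i x) (s j x) : ℝ)).det :=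
  (Matrix.posDef_gram_of_linearIndependent (hs.frame.linearIndependent hx)).det_pos

/-- Cramer's rule for the components of a vector with respect to a frame. -/
theorem IsCoordFrameOn.coeff_eq_det_div (hs : IsCoordFrameOn s U) {x : M} (hx : x ∈ U)
    (v : TangentSpace (𝓡 n) x) (k : Fin n) :
    hs.frame.coeff k x v
      = (Matrix.of fun i j ↦ if i = k then (inner ℝ (s j x) v : ℝ) else inner ℝ (s i x) (s j x)).det
        / (Matrix.of fun i j ↦ (inner ℝ (s i x) (s j x) : ℝ)).det := by
  rw [eq_div_iff (hs.det_gram_pos hx).ne', mul_comm]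
  set G := Matrix.of fun i j ↦ (inner ℝ (s i x) (s j x) : ℝ)
  -- Pairing the expansion of `v` with the frame gives a linear system for its components, with the
  -- Gram matrix as coefficients.
  have hb : (fun j ↦ (inner ℝ (s j x) v : ℝ)) = G.mulVec (fun i ↦ hs.frame.coeff i x v) := by
    ext j
    conv_lhs => rw [← hs.sum_coeff hx v, inner_sum]
    simp [G, Matrix.mulVec, dotProduct, inner_smul_right, mul_comm]
  have hG : G.transpose = G := by ext i j; exact real_inner_comm (s i x) (s j x)
  have h1 : (Matrix.of fun i j ↦ if i = k then (inner ℝ (s j x) v : ℝ)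
      else inner ℝ (s i x) (s j x)) = G.updateRow k (fun j ↦ (inner ℝ (s j x) v : ℝ)) := by
    ext i j
    by_cases h : i = k <;> simp [h, G, Matrix.updateRow_apply]
  rw [h1, ← Matrix.cramer_transpose_apply, hG, hb, Matrix.cramer_eq_adjugate_mulVec,
    Matrix.mulVec_mulVec, Matrix.adjugate_mul]
  simp [Matrix.smul_mulVec]

variable [IsContMDiffRiemannianBundle (𝓡 n) ∞ (EuclideanSpace ℝ (Fin n))
    (fun x : M ↦ TangentSpace (𝓡 n) x)]

theorem IsSmoothFieldOn.inner {X Y : Π x : M, TangentSpace (𝓡 n) x}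
    (hX : IsSmoothFieldOn X U) (hY : IsSmoothFieldOn Y U) :
    ContMDiffOn (𝓡 n) 𝓘(ℝ) ∞ (fun x ↦ (inner ℝ (X x) (Y x) : ℝ)) U :=
  ContMDiffOn.inner_bundle hX hY

theorem IsCoordFrameOn.contMDiffOn_det_gram (hs : IsCoordFrameOn s U) :
    ContMDiffOn (𝓡 n) 𝓘(ℝ) ∞
      (fun x ↦ (Matrix.of fun i j ↦ (inner ℝ (s i x) (s j x) : ℝ)).det) U :=
  contMDiffOn_det fun i j ↦ (hs.isSmoothFieldOn i).inner (hs.isSmoothFieldOn j)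

/-- Cramer's rule writes the components as quotients of smooth functions with positive denominator.
Smoothness can thus be tested on inner products, which is all that the definition of the dual
connection gives access to. -/
theorem IsCoordFrameOn.contMDiffOn_coeff_of_inner (hs : IsCoordFrameOn s U)
    {X : Π x : M, TangentSpace (𝓡 n) x}
    (hX : ∀ i, ContMDiffOn (𝓡 n) 𝓘(ℝ) ∞ (fun x ↦ (inner ℝ (s i x) (X x) : ℝ)) U) (k : Fin n) :
    ContMDiffOn (𝓡 n) 𝓘(ℝ) ∞ (fun x ↦ hs.frame.coeff k x (X x)) U := by
  refine ContMDiffOn.congr (ContMDiffOn.div₀ ?_ hs.contMDiffOn_det_gram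
    fun x hx ↦ (hs.det_gram_pos hx).ne') fun x hx ↦ hs.coeff_eq_det_div hx _ k
  refine contMDiffOn_det (a := fun i j x ↦ if i = k then (inner ℝ (s j x) (X x) : ℝ)
    else inner ℝ (s i x) (s j x)) fun i j ↦ ?_
  by_cases h : i = k
  · simpa [h] using hX j
  · simpa [h] using (hs.isSmoothFieldOn i).inner (hs.isSmoothFieldOn j)

theorem IsCoordFrameOn.contMDiffOn_coeff (hs : IsCoordFrameOn s U)
    {X : Π x : M, TangentSpace (𝓡 n) x} (hX : IsSmoothFieldOn X U) (k : Fin n) :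
    ContMDiffOn (𝓡 n) 𝓘(ℝ) ∞ (fun x ↦ hs.frame.coeff k x (X x)) U :=
  hs.contMDiffOn_coeff_of_inner (fun i ↦ (hs.isSmoothFieldOn i).inner hX) k

theorem IsCoordFrameOn.isSmoothFieldOn_of_inner (hs : IsCoordFrameOn s U)
    {X : Π x : M, TangentSpace (𝓡 n) x}
    (hX : ∀ i, ContMDiffOn (𝓡 n) 𝓘(ℝ) ∞ (fun x ↦ (inner ℝ (s i x) (X x) : ℝ)) U) :
    IsSmoothFieldOn X U :=
  hs.frame.contMDiffOn_of_coeff fun k ↦ hs.contMDiffOn_coeff_of_inner hX k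

theorem IsCoordFrameOn.mdifferentiableAt_coeff (hs : IsCoordFrameOn s U)
    {X : Π x : M, TangentSpace (𝓡 n) x} (hX : IsSmoothFieldOn X U) (k : Fin n) {x : M}
    (hx : x ∈ U) : MDifferentiableAt (𝓡 n) 𝓘(ℝ) (fun x ↦ hs.frame.coeff k x (X x)) x :=
  ((hs.contMDiffOn_coeff hX k).contMDiffAt (hs.isOpen.mem_nhds hx)).mdifferentiableAt (by simp)

end Frame

section Expansion

variable {s : Fin n → Π x : M, TangentSpace (𝓡 n) x} {U : Set M}

/-- Additivity and the Leibniz rule, by induction. The differentiability of the partial sum is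
carried along because additivity requires it. -/
theorem cov_sum_smul (cov : AffineConnection n M) {ι : Type*} (t : Finset ι)
    {f : ι → M → ℝ} {X : ι → Π x : M, TangentSpace (𝓡 n) x} {x : M}
    (hf : ∀ i ∈ t, MDifferentiableAt (𝓡 n) 𝓘(ℝ) (f i) x)
    (hX : ∀ i ∈ t, MDifferentiableAt (𝓡 n) ((𝓡 n).prod 𝓘(ℝ, EuclideanSpace ℝ (Fin n)))
      (fun y ↦ TotalSpace.mk' (EuclideanSpace ℝ (Fin n)) y (X i y)) x)
    (v : TangentSpace (𝓡 n) x) :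
    MDifferentiableAt (𝓡 n) ((𝓡 n).prod 𝓘(ℝ, EuclideanSpace ℝ (Fin n)))
      (fun y ↦ TotalSpace.mk' (EuclideanSpace ℝ (Fin n)) y ((∑ i ∈ t, f i • X i) y)) x ∧
    cov (∑ i ∈ t, f i • X i) x v
      = ∑ i ∈ t, (f i x • cov (X i) x v + mvfderiv (𝓡 n) (f i) x v • X i x) := by
  classical
  induction t using Finset.induction_on with
  | empty =>
    refine ⟨mdifferentiableAt_zeroSection .., ?_⟩
    simp
  | insert i t hi IH =>
    obtain ⟨h1, h2⟩ := IH (fun j hj ↦ hf j (Finset.mem_insert_of_mem hj))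
      fun j hj ↦ hX j (Finset.mem_insert_of_mem hj)
    have h3 := hf i (Finset.mem_insert_self i t)
    have h4 := hX i (Finset.mem_insert_self i t)
    have h5 := h3.smul_section h4
    rw [Finset.sum_insert hi, Finset.sum_insert hi]
    refine ⟨mdifferentiableAt_add_section h5 h1, ?_⟩
    rw [cov.isCovariantDerivativeOnUniv.add h5 h1, add_apply, h2,
      cov.isCovariantDerivativeOnUniv.leibniz h4 h3]
    rfl

variable [RiemannianBundle (fun x : M ↦ TangentSpace (𝓡 n) x)]
  [IsContMDiffRiemannianBundle (𝓡 n) ∞ (EuclideanSpace ℝ (Fin n))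
    (fun x : M ↦ TangentSpace (𝓡 n) x)]

theorem IsCoordFrameOn.coeff_cov (hs : IsCoordFrameOn s U) (cov : AffineConnection n M)
    {X : Π x : M, TangentSpace (𝓡 n) x} (hX : IsSmoothFieldOn X U) {x : M} (hx : x ∈ U)
    (v : TangentSpace (𝓡 n) x) (k : Fin n) :
    hs.frame.coeff k x (cov X x v) = mvfderiv (𝓡 n) (fun y ↦ hs.frame.coeff k y (X y)) x v
      + ∑ i, hs.frame.coeff i x (X x) * hs.frame.coeff k x (cov (s i) x v) := by
  have hU := hs.isOpen.mem_nhds hx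
  obtain ⟨h1, h2⟩ := cov_sum_smul cov Finset.univ (f := fun i y ↦ hs.frame.coeff i y (X y))
    (X := s) (x := x) (fun i _ ↦ hs.mdifferentiableAt_coeff hX i hx)
    (fun i _ ↦ (hs.isSmoothFieldOn i).mdifferentiableAt hU) v
  -- The expansion in the frame holds only over `U`; a connection is local, so this suffices.
  have h3 : cov X x = cov (∑ i, (fun y ↦ hs.frame.coeff i y (X y)) • s i) x := by
    refine cov.isCovariantDerivativeOnUniv.congr_of_eventuallyEq (hX.mdifferentiableAt hU) h1
      Filter.univ_mem ?_
    filter_upwards [hU] with y hy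
    rw [Finset.sum_apply]
    exact (hs.sum_coeff hy (X y)).symm
  rw [h3, h2, map_sum]
  simp only [map_add, map_smul, smul_eq_mul, hs.coeff_self hx, Finset.sum_add_distrib]
  simp [add_comm]

end Expansion

end StatMfd

/-! ### The trace of the connection form and parallel volume forms -/

namespace StatMfd

variable {n : ℕ} {M : Type*} [TopologicalSpace M] [ChartedSpace (EuclideanSpace ℝ (Fin n)) M]
  [IsManifold (𝓡 n) ∞ M] {s : Fin n → Π x : M, TangentSpace (𝓡 n) x} {U : Set M}

/-- The matrix, in the frame `s`, of the connection form of `cov` evaluated at `v`. -/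
noncomputable def IsCoordFrameOn.connMatrix (hs : IsCoordFrameOn s U) (cov : AffineConnection n M)
    (x : M) (v : TangentSpace (𝓡 n) x) : Matrix (Fin n) (Fin n) ℝ :=
  Matrix.of fun k i ↦ hs.frame.coeff k x (cov (s i) x v)

/-- The `n`-form taking the value `exp h` on the frame `s`. -/
noncomputable def IsCoordFrameOn.volumeForm (hs : IsCoordFrameOn s U) (h : M → ℝ) (x : M) :
    TangentSpace (𝓡 n) x [⋀^Fin n]→ₗ[ℝ] ℝ :=
  Real.exp (h x) •
    Matrix.detRowAlternating.compLinearMap (LinearMap.pi fun i ↦ hs.frame.coeff i x)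

theorem IsCoordFrameOn.volumeForm_apply (hs : IsCoordFrameOn s U) (h : M → ℝ) (x : M)
    (v : Fin n → TangentSpace (𝓡 n) x) :
    hs.volumeForm h x v
      = Real.exp (h x) * (Matrix.of fun j i ↦ hs.frame.coeff i x (v j)).det := rfl

variable [RiemannianBundle (fun x : M ↦ TangentSpace (𝓡 n) x)]
  [IsContMDiffRiemannianBundle (𝓡 n) ∞ (EuclideanSpace ℝ (Fin n))
    (fun x : M ↦ TangentSpace (𝓡 n) x)]

theorem IsCoordFrameOn.contMDiffOn_trace_connMatrix (hs : IsCoordFrameOn s U)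
    {cov : AffineConnection n M} (hcov : CovariantDerivative.ContMDiffCovariantDerivative cov ∞)
    (j : Fin n) :
    ContMDiffOn (𝓡 n) 𝓘(ℝ) ∞ (fun x ↦ (hs.connMatrix cov x (s j x)).trace) U := by
  unfold Matrix.trace
  exact contMDiffOn_finsetSum fun i _ ↦ hs.contMDiffOn_coeff
    ((isSmoothFieldOn_cov hcov (hs.smooth j) (hs.smooth i)).mono (subset_univ _)) i

/-- Constant curvature makes the trace of the connection form closed. -/
theorem IsCoordFrameOn.mvfderiv_trace_connMatrix_symm (hs : IsCoordFrameOn s U)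
    {cov : AffineConnection n M} (hcov : CovariantDerivative.ContMDiffCovariantDerivative cov ∞)
    (hcurv : HasConstantCurvature cov) (i j : Fin n) {x : M} (hx : x ∈ U) :
    mvfderiv (𝓡 n) (fun y ↦ (hs.connMatrix cov y (s i y)).trace) x (s j x)
      = mvfderiv (𝓡 n) (fun y ↦ (hs.connMatrix cov y (s j y)).trace) x (s i x) := by
  obtain ⟨K, hK⟩ := hcurv
  have hsm (j k : Fin n) : IsSmoothFieldOn (fun y ↦ cov (s k) y (s j y)) U :=
    (isSmoothFieldOn_cov hcov (hs.smooth j) (hs.smooth k)).mono (subset_univ _)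
  -- With `Aᵢ` the connection matrix along `sᵢ`, the trace of the second covariant derivative is
  -- `sⱼ(tr Aᵢ) + tr(Aⱼ Aᵢ)`.
  have htr (i j : Fin n) : ∑ k, hs.frame.coeff k x (cov (fun y ↦ cov (s k) y (s i y)) x (s j x))
      = mvfderiv (𝓡 n) (fun y ↦ (hs.connMatrix cov y (s i y)).trace) x (s j x)
        + (hs.connMatrix cov x (s j x) * hs.connMatrix cov x (s i x)).trace := by
    have h := mvfderiv_fun_sum Finset.univ (x := x)
      (f := fun k y ↦ hs.frame.coeff k y (cov (s k) y (s i y)))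
      fun k _ ↦ hs.mdifferentiableAt_coeff (hsm i k) k hx
    have h1 : mvfderiv (𝓡 n) (fun y ↦ (hs.connMatrix cov y (s i y)).trace) x (s j x) = _ :=
      h.2 (s j x)
    rw [h1, Matrix.trace, ← Finset.sum_add_distrib]
    refine Finset.sum_congr rfl fun k _ ↦ ?_
    rw [hs.coeff_cov cov (hsm i k) hx, Matrix.diag_apply, Matrix.mul_apply]
    simp only [connMatrix, Matrix.of_apply, mul_comm]
  -- The endomorphism `Z ↦ g(Y, Z)X - g(X, Z)Y` has trace `g(Y, X) - g(X, Y) = 0`.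
  have hzero : ∑ k, hs.frame.coeff k x (curvature cov (s i) (s j) (s k) x) = 0 := by
    simp_rw [hK _ _ _ (hs.smooth i) (hs.smooth j) (hs.smooth _) x, map_smul, map_sub, map_smul,
      hs.coeff_self hx]
    simp [← Finset.mul_sum, real_inner_comm (s i x) (s j x)]
  have hR : ∑ k, hs.frame.coeff k x (curvature cov (s i) (s j) (s k) x)
      = ∑ k, hs.frame.coeff k x (cov (fun y ↦ cov (s k) y (s j y)) x (s i x))
        - ∑ k, hs.frame.coeff k x (cov (fun y ↦ cov (s k) y (s i y)) x (s j x)) := by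
    rw [← Finset.sum_sub_distrib]
    refine Finset.sum_congr rfl fun k _ ↦ ?_
    rw [curvature, hs.mlieBracket_eq_zero i j x hx, map_zero, sub_zero, map_sub]
  -- The quadratic terms cancel since `tr(Aⱼ Aᵢ) = tr(Aᵢ Aⱼ)`; only the exterior derivative of the
  -- trace form remains.
  rw [hR, htr, htr, Matrix.trace_mul_comm] at hzero
  linarith

/-- The logarithmic derivative of the Gram determinant is the sum of the traces of the connection
forms of a connection and of its dual. -/
theorem IsCoordFrameOn.mvfderiv_det_gram (hs : IsCoordFrameOn s U) (cov : AffineConnection n M)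
    (k : Fin n) {x : M} (hx : x ∈ U) :
    mvfderiv (𝓡 n) (fun y ↦ (Matrix.of fun i j ↦ (inner ℝ (s i y) (s j y) : ℝ)).det) x (s k x)
      = (Matrix.of fun i j ↦ (inner ℝ (s i x) (s j x) : ℝ)).det
        * ((hs.connMatrix cov x (s k x)).trace + (hs.connMatrix (dual cov) x (s k x)).trace) := by
  have hU := hs.isOpen.mem_nhds hx
  have hd (i : Fin n) := (hs.isSmoothFieldOn i).mdifferentiableAt hU
  rw [mvfderiv_det (a := fun i j y ↦ (inner ℝ (s i y) (s j y) : ℝ)) fun i j ↦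
    (((hs.isSmoothFieldOn i).inner (hs.isSmoothFieldOn j)).contMDiffAt hU).mdifferentiableAt
      (by simp)]
  set G := Matrix.of fun i j ↦ (inner ℝ (s i x) (s j x) : ℝ)
  set A := hs.connMatrix cov x (s k x)
  set A' := hs.connMatrix (dual cov) x (s k x)
  -- The duality equation in matrix form, `dG = Aᵀ G + G A*`. Multiplied by the adjugate of `G`,
  -- each term has trace `det G` times that of a connection matrix.
  have h1 : (Matrix.of fun i j ↦ mvfderiv (𝓡 n) (fun y ↦ (inner ℝ (s i y) (s j y) : ℝ)) x (s k x))
      = A.transpose * G + G * A' := by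
    ext i j
    rw [Matrix.of_apply, dual_spec cov x (s k) (s i) (s j) (hd i) (hd j)]
    conv_lhs => rw [← hs.sum_coeff hx (cov (s i) x (s k x)),
      ← hs.sum_coeff hx (dual cov (s j) x (s k x))]
    simp only [sum_inner, inner_sum, Matrix.add_apply, Matrix.mul_apply, inner_smul_left,
      inner_smul_right, Matrix.transpose_apply, A, A', G, connMatrix, Matrix.of_apply]
    simp [mul_comm]
  have h2 : (G * A' * G.adjugate).trace = G.det * A'.trace := by
    rw [Matrix.trace_mul_comm, ← Matrix.mul_assoc, Matrix.adjugate_mul]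
    simp
  have h3 : (A.transpose * G * G.adjugate).trace = G.det * A.trace := by
    rw [Matrix.mul_assoc, Matrix.mul_adjugate]
    simp
  rw [h1, Matrix.add_mul, Matrix.trace_add, h2, h3]
  ring

/-- `exp h` times the dual volume form of a frame is parallel if `dh` is the trace of the connection
form. -/
theorem IsCoordFrameOn.isParallelVolumeFormOn (hs : IsCoordFrameOn s U)
    (cov : AffineConnection n M) {h : M → ℝ} (hh : ContMDiffOn (𝓡 n) 𝓘(ℝ) ∞ h U)
    (hd : ∀ k, ∀ x ∈ U, mvfderiv (𝓡 n) h x (s k x) = (hs.connMatrix cov x (s k x)).trace) :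
    IsParallelVolumeFormOn cov (hs.volumeForm h) U where
  smooth Y hY := by
    simp_rw [hs.volumeForm_apply]
    exact (Real.contDiff_exp.contMDiff.comp_contMDiffOn hh).mul
      (contMDiffOn_det fun j i ↦ hs.contMDiffOn_coeff (hY j) i)
  ne_zero x hx h0 := by
    have h1 := DFunLike.congr_fun h0 (fun i ↦ s i x)
    rw [hs.volumeForm_apply] at h1
    have h2 : (Matrix.of fun j i ↦ hs.frame.coeff i x (s j x)) = (1 : Matrix (Fin n) (Fin n) ℝ) := by
      ext j i
      simp [hs.coeff_self hx, Matrix.one_apply, eq_comm]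
    rw [h2, Matrix.det_one, mul_one] at h1
    exact (Real.exp_pos _).ne' h1
  parallel X Y hX hY x hx := by
    have hU := hs.isOpen.mem_nhds hx
    have hdX : mvfderiv (𝓡 n) h x (X x) = (hs.connMatrix cov x (X x)).trace := by
      rw [← hs.sum_coeff hx (X x), map_sum]
      simp only [map_smul, hd _ x hx]
      simp only [Matrix.trace, Matrix.diag, connMatrix, Matrix.of_apply, map_sum, map_smul,
        smul_eq_mul, Finset.mul_sum]
      exact Finset.sum_comm
    have hh' : MDifferentiableAt (𝓡 n) 𝓘(ℝ) h x :=
      (hh.contMDiffAt hU).mdifferentiableAt (by simp)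
    set A := hs.connMatrix cov x (X x)
    set c := Matrix.of fun j i ↦ hs.frame.coeff i x (Y j x) with hc
    set c' := Matrix.of fun j i ↦ mvfderiv (𝓡 n) (fun y ↦ hs.frame.coeff i y (Y j y)) x (X x)
      with hc'
    have hexp : mvfderiv (𝓡 n) (fun y ↦ Real.exp (h y)) x (X x) = Real.exp (h x) * A.trace := by
      rw [(mvfderiv_comp_deriv (Real.hasDerivAt_exp (h x)) hh').2, hdX]
    have hder : mvfderiv (𝓡 n) (fun y ↦ hs.volumeForm h y (fun j ↦ Y j y)) x (X x)
        = Real.exp (h x) * ((c' * c.adjugate).trace + A.trace * c.det) := by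
      simp_rw [hs.volumeForm_apply]
      rw [mvfderiv_fun_mul, add_apply, smul_apply, smul_apply, hexp,
        mvfderiv_det fun j i ↦ hs.mdifferentiableAt_coeff (hY j) i hx]
      · simp only [smul_eq_mul, ← hc, ← hc']
        ring
      · exact (mvfderiv_comp_deriv (Real.hasDerivAt_exp (h x)) hh').1
      · exact ((contMDiffOn_det fun j i ↦ hs.contMDiffOn_coeff (hY j) i).contMDiffAt
          hU).mdifferentiableAt (by simp)
    -- The rows of `c' + c Aᵀ` are the components of the fields `∇_X Yⱼ`. The `c'` part matches
    -- Jacobi's formula and the other part matches the derivative of `exp h`. Working with the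
    -- adjugate avoids assuming that the `Yⱼ` are independent.
    have hsum : ∑ i, hs.volumeForm h x (Function.update (fun j ↦ Y j x) i (cov (Y i) x (X x)))
        = Real.exp (h x) * ((c' + c * A.transpose) * c.adjugate).trace := by
      rw [← sum_det_updateRow, Finset.mul_sum]
      refine Finset.sum_congr rfl fun j _ ↦ ?_
      rw [hs.volumeForm_apply]
      congr 2
      ext l i
      rcases eq_or_ne l j with rfl | hl
      · simp [hs.coeff_cov cov (hY _) hx, c', c, A, connMatrix, Matrix.mul_apply]
      · simp [hl, c]
    have htr : (c * A.transpose * c.adjugate).trace = A.trace * c.det := by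
      rw [Matrix.trace_mul_comm, ← Matrix.mul_assoc, Matrix.adjugate_mul]
      simp [mul_comm]
    rw [covDerivForm, hder, hsum, Matrix.add_mul, Matrix.trace_add, htr, sub_self]

end StatMfd

/-! ### The dual connection and the `α`-connections -/

namespace StatMfd

variable {n : ℕ} {M : Type*} [TopologicalSpace M] [ChartedSpace (EuclideanSpace ℝ (Fin n)) M]
  [IsManifold (𝓡 n) ∞ M]

/-- A field of endomorphisms of the tangent spaces is smooth at `p` if its values on the coordinate
vector fields at `p` are. -/
theorem contMDiffAt_hom_of_coordField {Φ : Π x : M, TangentSpace (𝓡 n) x →L[ℝ] TangentSpace (𝓡 n) x}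
    {p : M} (h : ∀ i, ContMDiffAt (𝓡 n) ((𝓡 n).prod 𝓘(ℝ, EuclideanSpace ℝ (Fin n))) ∞
      (fun x ↦ TotalSpace.mk' (EuclideanSpace ℝ (Fin n)) x (Φ x (coordField p i x))) p) :
    ContMDiffAt (𝓡 n)
      ((𝓡 n).prod 𝓘(ℝ, EuclideanSpace ℝ (Fin n) →L[ℝ] EuclideanSpace ℝ (Fin n))) ∞
      (fun x ↦ TotalSpace.mk' (EuclideanSpace ℝ (Fin n) →L[ℝ] EuclideanSpace ℝ (Fin n))
        (E := fun x : M ↦ TangentSpace (𝓡 n) x →L[ℝ] TangentSpace (𝓡 n) x) x (Φ x)) p := by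
  refine (contMDiffAt_hom_bundle _).2 ⟨contMDiffAt_id, ?_⟩
  let e := trivializationAt (EuclideanSpace ℝ (Fin n)) (TangentSpace (𝓡 n)) p
  let w (i : Fin n) (x : M) : EuclideanSpace ℝ (Fin n) :=
    (e ⟨x, Φ x (coordField p i x)⟩).2
  have hw (i : Fin n) : ContMDiffAt (𝓡 n) 𝓘(ℝ, EuclideanSpace ℝ (Fin n)) ∞ (w i) p :=
    (contMDiffAt_totalSpace.1 (h i)).2
  -- In the trivialization `Φ` is `∑ᵢ dxᵢ ⊗ wᵢ`, and `R i` is the constant linear map `w ↦ dxᵢ ⊗ w`.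
  let R (i : Fin n) : EuclideanSpace ℝ (Fin n) →L[ℝ]
      EuclideanSpace ℝ (Fin n) →L[ℝ] EuclideanSpace ℝ (Fin n) :=
    ContinuousLinearMap.smulRightL ℝ _ _ (EuclideanSpace.proj i)
  have hsum : ContMDiffAt (𝓡 n)
      𝓘(ℝ, EuclideanSpace ℝ (Fin n) →L[ℝ] EuclideanSpace ℝ (Fin n)) ∞
      (fun x ↦ ∑ i, R i (w i x)) p :=
    contMDiffAt_finsetSum fun i _ ↦ (R i).contMDiff.contMDiffAt.comp p (hw i)
  refine hsum.congr_of_eventuallyEq ?_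
  filter_upwards [e.open_baseSet.mem_nhds (mem_baseSet_trivializationAt _ _ p)] with x hx
  have hcoord (i : Fin n) : (e.continuousLinearEquivAt ℝ x hx).symm
      (EuclideanSpace.basisFun (Fin n) ℝ i) = coordField p i x := by
    rw [coordField, Trivialization.localFrame_apply_of_mem_baseSet _ _ hx, Trivialization.basisAt,
      Module.Basis.map_apply, OrthonormalBasis.coe_toBasis]
    rfl
  refine ContinuousLinearMap.coe_injective
    ((EuclideanSpace.basisFun (Fin n) ℝ).toBasis.ext fun j ↦ ?_)
  have h1 : (ContinuousLinearMap.inCoordinates (EuclideanSpace ℝ (Fin n)) (TangentSpace (𝓡 n))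
      (EuclideanSpace ℝ (Fin n)) (TangentSpace (𝓡 n)) p x p x (Φ x))
        (EuclideanSpace.basisFun (Fin n) ℝ j) = w j x := by
    rw [ContinuousLinearMap.inCoordinates_eq hx hx]
    change e.continuousLinearEquivAt ℝ x hx (Φ x ((e.continuousLinearEquivAt ℝ x hx).symm _)) = _
    rw [hcoord]
    rfl
  have h2 : (∑ i, R i (w i x)) (EuclideanSpace.basisFun (Fin n) ℝ j) = w j x := by
    simp [R]
  simpa using h1.trans h2.symm

variable [RiemannianBundle (fun x : M ↦ TangentSpace (𝓡 n) x)]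
  [IsContMDiffRiemannianBundle (𝓡 n) ∞ (EuclideanSpace ℝ (Fin n))
    (fun x : M ↦ TangentSpace (𝓡 n) x)]

/-- The dual of a smooth connection is smooth. -/
theorem contMDiff_dual [T2Space M] {cov : AffineConnection n M}
    (hcov : CovariantDerivative.ContMDiffCovariantDerivative cov ∞) :
    CovariantDerivative.ContMDiffCovariantDerivative (dual cov) ∞ := by
  refine ⟨⟨fun {Z} hZ ↦ ?_⟩⟩
  have hZ' : IsSmoothFieldOn Z univ := by simpa [IsSmoothFieldOn] using hZ
  refine contMDiffOn_univ.2 fun p ↦ contMDiffAt_hom_of_coordField fun i ↦ ?_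
  obtain ⟨U, s, hp, hsU, hs⟩ := exists_isCoordFrameOn (n := n) p
  have hZU : IsSmoothFieldOn Z U := hZ'.mono (subset_univ _)
  have hsm : IsSmoothFieldOn (fun x ↦ dual cov Z x (s i x)) U := by
    refine hs.isSmoothFieldOn_of_inner fun j ↦ ?_
    -- By duality `g(sⱼ, ∇*_{sᵢ} Z) = sᵢ g(sⱼ, Z) - g(∇_{sᵢ} sⱼ, Z)`, and the right-hand side
    -- involves only the smooth data `g`, `∇` and `Z`.
    have h1 : ContMDiffOn (𝓡 n) 𝓘(ℝ) ∞ (fun x ↦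
        mvfderiv (𝓡 n) (fun y ↦ (inner ℝ (s j y) (Z y) : ℝ)) x (s i x)
          - (inner ℝ (cov (s j) x (s i x)) (Z x) : ℝ)) U :=
      (hs.contMDiffOn_mvfderiv _ ((hs.isSmoothFieldOn j).inner hZU) i).sub
        (IsSmoothFieldOn.inner
          ((isSmoothFieldOn_cov hcov (hs.smooth i) (hs.smooth j)).mono (subset_univ _)) hZU)
    refine h1.congr fun x hx ↦ ?_
    have hU := hs.isOpen.mem_nhds hx
    rw [dual_spec cov x (s i) (s j) Z ((hs.isSmoothFieldOn j).mdifferentiableAt hU)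
      (hZU.mdifferentiableAt hU)]
    ring
  refine (hsm.contMDiffAt (hs.isOpen.mem_nhds hp)).congr_of_eventuallyEq ?_
  filter_upwards [hs.isOpen.mem_nhds hp] with x hx
  rw [hsU i x hx]

theorem contMDiff_alphaConnection [T2Space M] {cov : AffineConnection n M}
    (hcov : CovariantDerivative.ContMDiffCovariantDerivative cov ∞) (α : ℝ) :
    CovariantDerivative.ContMDiffCovariantDerivative (alphaConnection cov α) ∞ :=
  CovariantDerivative.ContMDiffCovariantDerivative.affineCombination _ _ contMDiff_const hcov
    (contMDiff_dual hcov)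

/-- Paired with any `w`, the two sides are values of the cubic form that differ by a swap of its
first two arguments. -/
theorem raiseIndex_derivMetricTensor_symm {cov : AffineConnection n M} (hstat : IsStatistical cov)
    (x : M) (Y X : TangentSpace (𝓡 n) x) :
    raiseIndex (cov.derivMetricTensor x) Y X = raiseIndex (cov.derivMetricTensor x) X Y := by
  refine ext_inner_left ℝ fun w ↦ ?_
  rw [inner_raiseIndex, inner_raiseIndex]
  have h1 := hstat.symm₁₂ x X Y w
  have h2 := hstat.symm₂₃ x X Y w
  have h3 := hstat.symm₂₃ x Y X w
  simp only [cubicForm] at h1 h2 h3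
  linarith

/-- `∇^(α)` differs from `∇` by `(1 - α)/2` times a symmetric tensor, which does not affect the
torsion. -/
theorem torsion_alphaConnection {cov : AffineConnection n M} (hstat : IsStatistical cov) (α : ℝ) :
    (alphaConnection cov α).torsion = 0 := by
  rw [CovariantDerivative.torsion_eq_zero_iff]
  intro X Y x hX hY
  have h := (CovariantDerivative.torsion_eq_zero_iff cov).1 hstat.torsion_free hX hY
  rw [← h, alphaConnection_apply, alphaConnection_apply, dual_apply, dual_apply,
    raiseIndex_derivMetricTensor_symm hstat x (Y x) (X x)]
  module

theorem IsCoordFrameOn.trace_connMatrix_alphaConnection {s : Fin n → Π x : M, TangentSpace (𝓡 n) x}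
    {U : Set M} (hs : IsCoordFrameOn s U) (cov : AffineConnection n M) (α : ℝ) (x : M)
    (v : TangentSpace (𝓡 n) x) :
    (hs.connMatrix (alphaConnection cov α) x v).trace
      = (1 + α) / 2 * (hs.connMatrix cov x v).trace
        + (1 - α) / 2 * (hs.connMatrix (dual cov) x v).trace := by
  simp [Matrix.trace, connMatrix, alphaConnection_apply, Finset.sum_add_distrib, Finset.mul_sum]

/-- Over the domain of a coordinate frame, the trace of the connection form of every
`α`-connection of a connection of constant curvature is exact. -/
theorem IsCoordFrameOn.exists_primitive_trace_connMatrix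
    {s : Fin n → Π x : M, TangentSpace (𝓡 n) x}
    {U : Set M} (hs : IsCoordFrameOn s U) {cov : AffineConnection n M}
    (hcov : CovariantDerivative.ContMDiffCovariantDerivative cov ∞)
    (hcurv : HasConstantCurvature cov) (α : ℝ) :
    ∃ h : M → ℝ, ContMDiffOn (𝓡 n) 𝓘(ℝ) ∞ h U ∧ ∀ k, ∀ x ∈ U,
      mvfderiv (𝓡 n) h x (s k x) = (hs.connMatrix (alphaConnection cov α) x (s k x)).trace := by
  obtain ⟨φ, hφ, hφd⟩ := hs.exists_primitive
    (fun i x ↦ (hs.connMatrix cov x (s i x)).trace) (hs.contMDiffOn_trace_connMatrix hcov)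
    fun i j x hx ↦ hs.mvfderiv_trace_connMatrix_symm hcov hcurv i j hx
  set D : M → ℝ := fun x ↦ (Matrix.of fun i j ↦ (inner ℝ (s i x) (s j x) : ℝ)).det
  have hDpos {x} (hx : x ∈ U) : 0 < D x := hs.det_gram_pos hx
  have hlog : ContMDiffOn (𝓡 n) 𝓘(ℝ) ∞ (fun x ↦ Real.log (D x)) U := fun x hx ↦
    ((Real.contDiffAt_log.2 (hDpos hx).ne').contMDiffAt.comp_contMDiffWithinAt x
      (hs.contMDiffOn_det_gram x hx))
  -- Substituting `τ* = d log D - τ` in `(1 + α)/2 τ + (1 - α)/2 τ*` leaves `α τ + (1 - α)/2 d log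
  -- D`.
  refine ⟨fun x ↦ α * φ x + (1 - α) / 2 * Real.log (D x),
    (contMDiffOn_const.mul hφ).add (contMDiffOn_const.mul hlog), fun k x hx ↦ ?_⟩
  have hU := hs.isOpen.mem_nhds hx
  have hφx : MDifferentiableAt (𝓡 n) 𝓘(ℝ) φ x := (hφ.contMDiffAt hU).mdifferentiableAt (by simp)
  have hDx : MDifferentiableAt (𝓡 n) 𝓘(ℝ) D x :=
    (hs.contMDiffOn_det_gram.contMDiffAt hU).mdifferentiableAt (by simp)
  obtain ⟨h1, h2⟩ := mvfderiv_comp_deriv (Real.hasDerivAt_log (hDpos hx).ne') hDx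
  have h3 : MDifferentiableAt (𝓡 n) 𝓘(ℝ) (fun y ↦ α * φ y) x := mdifferentiableAt_const.mul hφx
  have h4 : MDifferentiableAt (𝓡 n) 𝓘(ℝ) (fun y ↦ (1 - α) / 2 * Real.log (D y)) x :=
    mdifferentiableAt_const.mul h1
  rw [mvfderiv_fun_add h3 h4,
    add_apply, mvfderiv_fun_mul mdifferentiableAt_const hφx,
    mvfderiv_fun_mul mdifferentiableAt_const h1, mvfderiv_const, mvfderiv_const, smul_zero,
    smul_zero, add_zero, add_zero, smul_apply, smul_apply, h2, hφd k x hx,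
    hs.mvfderiv_det_gram cov k hx, hs.trace_connMatrix_alphaConnection]
  change α • _ + ((1 - α) / 2) • ((D x)⁻¹ * (D x * _)) = _
  rw [inv_mul_cancel_left₀ (hDpos hx).ne', smul_eq_mul, smul_eq_mul]
  ring

end StatMfd

theorem proposition3p2 {n : ℕ} {M : Type*} [TopologicalSpace M] [T2Space M]
    [ChartedSpace (EuclideanSpace ℝ (Fin n)) M] [IsManifold (𝓡 n) ∞ M]
    [RiemannianBundle (fun x : M ↦ TangentSpace (𝓡 n) x)]
    [IsContMDiffRiemannianBundle (𝓡 n) ∞ (EuclideanSpace ℝ (Fin n))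
      (fun x : M ↦ TangentSpace (𝓡 n) x)]
    (cov : StatMfd.AffineConnection n M) (hstat : StatMfd.IsStatistical cov)
    (hcurv : StatMfd.HasConstantCurvature cov) (α : ℝ) :
    StatMfd.IsEquiaffine (StatMfd.alphaConnection cov α) where
  smooth := StatMfd.contMDiff_alphaConnection hstat.smooth α
  torsion_free := StatMfd.torsion_alphaConnection hstat α
  exists_parallel p := by
    obtain ⟨U, s, hp, -, hs⟩ := StatMfd.exists_isCoordFrameOn (n := n) p
    obtain ⟨h, hh, hd⟩ := hs.exists_primitive_trace_connMatrix hstat.smooth hcurv α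
    exact ⟨U, hs.isOpen, hp, hs.volumeForm h, hs.isParallelVolumeFormOn _ hh hd⟩
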